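/- A loop is an algebra $(L,\cdot,\backslash,/,1)$ with three binary operations and a constant such that $1\cdot x = x = x\cdot 1$, $x\cdot(x\backslash y)=y=x\backslash(x\cdot y)$ and $(y/x)\cdot x=y=(y\cdot x)/x$ for all $x,y\in L$. A subloop is a subset containing $1$ and closed under the three operations; it is finitely generated if it is the smallest subloop containing some finite set. Let $A_1,A_2,A_3$ be finitely generated loops, and let $C$ be a subloop of the direct product $A_1\times A_2\times A_3$ that is a subdirect product, i.e. $C$ projects onto each factor $A_i$. Suppose moreover that $C$ projects onto $A_i\times A_j$ for all $1\le i<j\le 3$. Then $C$ is finitely generated. -/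

import Mathlib

/-- A (not necessarily associative) loop, as an algebra with three binary operations
(multiplication, left division and right division) and one constant `1`. -/
class Loop (A : Type*) extends MulOneClass A where
  /-- Left division: `ldiv a b` is the solution `x` of `a * x = b`. -/
  ldiv : A → A → A
  /-- Right division: `rdiv b a` is the solution `x` of `x * a = b`. -/
  rdiv : A → A → A
  mul_ldiv : ∀ a b : A, a * ldiv a b = b
  ldiv_mul : ∀ a b : A, ldiv a (a * b) = b
  rdiv_mul : ∀ b a : A, rdiv b a * a = b
  mul_rdiv : ∀ b a : A, rdiv (b * a) a = b

/-- The direct product of two loops, with componentwise operations. -/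
instance Prod.instLoop {A B : Type*} [Loop A] [Loop B] : Loop (A × B) where
  ldiv x y := (Loop.ldiv x.1 y.1, Loop.ldiv x.2 y.2)
  rdiv x y := (Loop.rdiv x.1 y.1, Loop.rdiv x.2 y.2)
  mul_ldiv x y := Prod.ext (Loop.mul_ldiv x.1 y.1) (Loop.mul_ldiv x.2 y.2)
  ldiv_mul x y := Prod.ext (Loop.ldiv_mul x.1 y.1) (Loop.ldiv_mul x.2 y.2)
  rdiv_mul x y := Prod.ext (Loop.rdiv_mul x.1 y.1) (Loop.rdiv_mul x.2 y.2)
  mul_rdiv x y := Prod.ext (Loop.mul_rdiv x.1 y.1) (Loop.mul_rdiv x.2 y.2)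

/-- A subloop: a subset closed under all the loop operations. -/
@[ext]
structure Subloop (A : Type*) [Loop A] where
  carrier : Set A
  one_mem : (1 : A) ∈ carrier
  mul_mem : ∀ {a b : A}, a ∈ carrier → b ∈ carrier → a * b ∈ carrier
  ldiv_mem : ∀ {a b : A}, a ∈ carrier → b ∈ carrier → Loop.ldiv a b ∈ carrier
  rdiv_mem : ∀ {a b : A}, a ∈ carrier → b ∈ carrier → Loop.rdiv a b ∈ carrier

namespace Subloop

instance {A : Type*} [Loop A] : SetLike (Subloop A) A where
  coe := Subloop.carrier
  coe_injective := fun _ _ h => Subloop.ext h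

/-- The whole loop, as a subloop of itself. -/
instance {A : Type*} [Loop A] : Top (Subloop A) where
  top :=
    { carrier := Set.univ
      one_mem := Set.mem_univ _
      mul_mem := fun _ _ => Set.mem_univ _
      ldiv_mem := fun _ _ => Set.mem_univ _
      rdiv_mem := fun _ _ => Set.mem_univ _ }

/-- The subloop generated by a set: the intersection of all subloops that contain it. -/
def closure {A : Type*} [Loop A] (X : Set A) : Subloop A where
  carrier := {a | ∀ S : Subloop A, X ⊆ (S : Set A) → a ∈ S}
  one_mem S _ := S.one_mem
  mul_mem ha hb S hS := S.mul_mem (ha S hS) (hb S hS)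
  ldiv_mem ha hb S hS := S.ldiv_mem (ha S hS) (hb S hS)
  rdiv_mem ha hb S hS := S.rdiv_mem (ha S hS) (hb S hS)

/-- A subloop is finitely generated if it is generated by a finite set. -/
def FG {A : Type*} [Loop A] (C : Subloop A) : Prop :=
  ∃ X : Set A, X.Finite ∧ closure X = C

/-- A subloop of a direct product of three loops is a subdirect product if it projects
onto each factor. -/
def IsSubdirect {A₁ A₂ A₃ : Type*} [Loop A₁] [Loop A₂] [Loop A₃]
    (C : Subloop (A₁ × A₂ × A₃)) : Prop :=
  (fun x : A₁ × A₂ × A₃ => x.1) '' (C : Set (A₁ × A₂ × A₃)) = Set.univ ∧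
  (fun x : A₁ × A₂ × A₃ => x.2.1) '' (C : Set (A₁ × A₂ × A₃)) = Set.univ ∧
  (fun x : A₁ × A₂ × A₃ => x.2.2) '' (C : Set (A₁ × A₂ × A₃)) = Set.univ

/-- A subloop of a direct product of three loops is surjective on pairs if it projects
onto the product of any two of the factors. -/
def SurjectiveOnPairs {A₁ A₂ A₃ : Type*} [Loop A₁] [Loop A₂] [Loop A₃]
    (C : Subloop (A₁ × A₂ × A₃)) : Prop :=
  (fun x : A₁ × A₂ × A₃ => (x.1, x.2.1)) '' (C : Set (A₁ × A₂ × A₃)) = Set.univ ∧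
  (fun x : A₁ × A₂ × A₃ => (x.1, x.2.2)) '' (C : Set (A₁ × A₂ × A₃)) = Set.univ ∧
  (fun x : A₁ × A₂ × A₃ => (x.2.1, x.2.2)) '' (C : Set (A₁ × A₂ × A₃)) = Set.univ

end Subloop

/-- A loop is finitely generated if it is generated by a finite subset. -/
def Loop.FG (A : Type*) [Loop A] : Prop :=
  (⊤ : Subloop A).FG

/-!
Let `C ≤ A₁ × A₂ × A₃` be surjective on pairs. Since each `Aᵢ × Aⱼ` is finitely generated, there is
a finitely generated `C₀ ≤ C` that is still surjective on pairs (`exists_fg_surjectiveOnPairs`).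
Call `a, a' : A₁` related when `(a, b), (a', b) ∈ C₀` for some `b : A₂ × A₃`. The Malcev term
`u * (v \ w)` makes this a congruence (`fiberCon`). Its quotient `G` is an abelian group
(`exists_commGroup_quotient`): as `C₀` contains triples `(a, 1, x)`, `(b, y, 1)`, `(c, 1, z)`,
the elements `a * b`, `b * a` occur in `C₀` over the same point of `A₂ × A₃`, and so do
`(a * b) * c`, `a * (b * c)`.

Being a finitely generated abelian group, `G` is Noetherian, so the image in `G` of
`{n | (n, 1) ∈ C}` is generated by the classes of finitely many `n` with `(n, 1) ∈ C`. Adding these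
`(n, 1)` to `C₀` yields all of `C`, because an element of `C` can be corrected by one of `C₀` with
the same last two coordinates (`le_of_fiber_image_le`).

Passing to `C₀` is what makes the argument work: `A₁` modulo `{n | (n, 1) ∈ C}` is also a finitely
generated abelian group, but such a group need not be finitely presented as a loop.
-/

universe u

namespace Loop

variable {A B : Type*} [Loop A] [Loop B]

theorem ldiv_self (a : A) : ldiv a a = 1 := by
  simpa using ldiv_mul a (1 : A)

theorem map_ldiv (f : A →* B) (a b : A) : f (ldiv a b) = ldiv (f a) (f b) := by
  rw [← ldiv_mul (f a) (f (ldiv a b)), ← map_mul, mul_ldiv]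

theorem map_rdiv (f : A →* B) (a b : A) : f (rdiv a b) = rdiv (f a) (f b) := by
  rw [← mul_rdiv (f (rdiv a b)) (f b), ← map_mul, rdiv_mul]

theorem map_ldiv_group {G : Type*} [Group G] (f : A →* G) (a b : A) :
    f (ldiv a b) = (f a)⁻¹ * f b := by
  rw [eq_inv_mul_iff_mul_eq, ← map_mul, mul_ldiv]

theorem map_rdiv_group {G : Type*} [Group G] (f : A →* G) (a b : A) :
    f (rdiv a b) = f a * (f b)⁻¹ := by
  rw [eq_mul_inv_iff_mul_eq, ← map_mul, rdiv_mul]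

end Loop

namespace Subloop

variable {A B : Type*} [Loop A] [Loop B]

/-! ### Closures, images and preimages -/

instance : PartialOrder (Subloop A) := .ofSetLike (Subloop A) A

theorem subset_closure (X : Set A) : X ⊆ (closure X : Set A) :=
  fun _ hx _ hS => hS hx

theorem closure_le {X : Set A} {S : Subloop A} (h : X ⊆ (S : Set A)) : closure X ≤ S :=
  fun _ ha => ha S h

/-- The preimage of a subloop under a homomorphism; a multiplicative map between loops preserves
both divisions. -/
def comap (f : A →* B) (S : Subloop B) : Subloop A where
  carrier := f ⁻¹' (S : Set B)
  one_mem := by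
    rw [Set.mem_preimage, map_one]
    exact S.one_mem
  mul_mem {a b} ha hb := by
    rw [Set.mem_preimage, map_mul]
    exact S.mul_mem ha hb
  ldiv_mem {a b} ha hb := by
    rw [Set.mem_preimage, Loop.map_ldiv]
    exact S.ldiv_mem ha hb
  rdiv_mem {a b} ha hb := by
    rw [Set.mem_preimage, Loop.map_rdiv]
    exact S.rdiv_mem ha hb

/-- The image of a subloop under a homomorphism. -/
def map (f : A →* B) (S : Subloop A) : Subloop B where
  carrier := f '' (S : Set A)
  one_mem := ⟨1, S.one_mem, map_one f⟩
  mul_mem := by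
    rintro _ _ ⟨a, ha, rfl⟩ ⟨b, hb, rfl⟩
    exact ⟨a * b, S.mul_mem ha hb, map_mul f a b⟩
  ldiv_mem := by
    rintro _ _ ⟨a, ha, rfl⟩ ⟨b, hb, rfl⟩
    exact ⟨Loop.ldiv a b, S.ldiv_mem ha hb, Loop.map_ldiv f a b⟩
  rdiv_mem := by
    rintro _ _ ⟨a, ha, rfl⟩ ⟨b, hb, rfl⟩
    exact ⟨Loop.rdiv a b, S.rdiv_mem ha hb, Loop.map_rdiv f a b⟩

/-- The preimage of a subgroup under a homomorphism from a loop to a group. -/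
def comapSubgroup {G : Type*} [Group G] (f : A →* G) (H : Subgroup G) : Subloop A where
  carrier := f ⁻¹' (H : Set G)
  one_mem := by
    rw [Set.mem_preimage, map_one]
    exact H.one_mem
  mul_mem {a b} ha hb := by
    rw [Set.mem_preimage, map_mul]
    exact H.mul_mem ha hb
  ldiv_mem {a b} ha hb := by
    rw [Set.mem_preimage, Loop.map_ldiv_group]
    exact H.mul_mem (H.inv_mem ha) hb
  rdiv_mem {a b} ha hb := by
    rw [Set.mem_preimage, Loop.map_rdiv_group]
    exact H.mul_mem ha (H.inv_mem hb)

/-- The image of a subloop under a homomorphism to a group. -/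
def mapSubgroup {G : Type*} [Group G] (f : A →* G) (S : Subloop A) : Subgroup G where
  carrier := f '' (S : Set A)
  one_mem' := ⟨1, S.one_mem, map_one f⟩
  mul_mem' := by
    rintro _ _ ⟨a, ha, rfl⟩ ⟨b, hb, rfl⟩
    exact ⟨a * b, S.mul_mem ha hb, map_mul f a b⟩
  inv_mem' := by
    rintro _ ⟨a, ha, rfl⟩
    exact ⟨Loop.ldiv a 1, S.ldiv_mem ha S.one_mem, by simp [Loop.map_ldiv_group]⟩

theorem mem_of_closure_eq_top {X : Set A} (hX : closure X = ⊤) {S : Subloop A}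
    (h : X ⊆ (S : Set A)) (a : A) : a ∈ S := by
  have ha : a ∈ (⊤ : Subloop A) := Set.mem_univ a
  rw [← hX] at ha
  exact closure_le h ha

theorem mem_of_generators_prod {X : Set A} {Y : Set B} (hX : closure X = ⊤) (hY : closure Y = ⊤)
    {S : Subloop (A × B)} (h₁ : ∀ x ∈ X, (x, (1 : B)) ∈ S) (h₂ : ∀ y ∈ Y, ((1 : A), y) ∈ S)
    (p : A × B) : p ∈ S := by
  have ha : (p.1, (1 : B)) ∈ S :=
    mem_of_closure_eq_top (S := comap (MonoidHom.inl A B) S) hX h₁ p.1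
  have hb : ((1 : A), p.2) ∈ S :=
    mem_of_closure_eq_top (S := comap (MonoidHom.inr A B) S) hY h₂ p.2
  have h : (p.1 * 1, 1 * p.2) ∈ S := S.mul_mem ha hb
  simpa using h

/-- Finitely many elements of `C` already generate a subloop that maps onto `A × B`, if `C` does. -/
theorem exists_finite_lift {D : Type*} [Loop D] (hA : Loop.FG A) (hB : Loop.FG B)
    (f : D →* A × B) (C : Subloop D) (hC : ∀ p, ∃ c ∈ C, f c = p) :
    ∃ Z : Set D, Z.Finite ∧ Z ⊆ C ∧ ∀ S : Subloop D, Z ⊆ S → ∀ p, ∃ c ∈ S, f c = p := by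
  obtain ⟨X, hXf, hX⟩ := hA
  obtain ⟨Y, hYf, hY⟩ := hB
  choose g hgC hg using hC
  refine ⟨g '' ((fun x => (x, 1)) '' X ∪ (fun y => (1, y)) '' Y),
    ((hXf.image _).union (hYf.image _)).image _, ?_, fun S hS => ?_⟩
  · rintro _ ⟨p, -, rfl⟩
    exact hgC p
  · exact mem_of_generators_prod (S := map f S) hX hY
      (fun x hx => ⟨_, hS ⟨_, Or.inl ⟨x, hx, rfl⟩, rfl⟩, hg _⟩)
      (fun y hy => ⟨_, hS ⟨_, Or.inr ⟨y, hy, rfl⟩, rfl⟩, hg _⟩)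

/-! ### The fiber congruence of a subdirect product -/

/-- The Malcev term `u * (v \ w)` applied to `(a', b), (a, b), (a, b')`. -/
theorem rectangular (C : Subloop (A × B)) {a a' : A} {b b' : B} (h : (a, b) ∈ C)
    (h' : (a', b) ∈ C) (hb' : (a, b') ∈ C) : (a', b') ∈ C := by
  have key : (a' * Loop.ldiv a a, b * Loop.ldiv b b') ∈ C := C.mul_mem h' (C.ldiv_mem h hb')
  rwa [Loop.ldiv_self, mul_one, Loop.mul_ldiv] at key

/-- For a subloop `C` of `A × B` that projects onto `A`, the congruence on `A` relating two elements
that occur in `C` with the same second coordinate. -/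
def fiberCon (C : Subloop (A × B)) (hC : ∀ a, ∃ b, (a, b) ∈ C) : Con A where
  r a a' := ∃ b, (a, b) ∈ C ∧ (a', b) ∈ C
  iseqv :=
    { refl := fun a => (hC a).imp fun _ h => ⟨h, h⟩
      symm := fun ⟨b, h, h'⟩ => ⟨b, h', h⟩
      trans := fun ⟨_, h₁, h₂⟩ ⟨b', h₃, h₄⟩ => ⟨b', C.rectangular h₂ h₁ h₃, h₄⟩ }
  mul' := fun ⟨b, h₁, h₂⟩ ⟨b', h₃, h₄⟩ => ⟨b * b', C.mul_mem h₁ h₃, C.mul_mem h₂ h₄⟩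

/-- If `C` is surjective on the pairs containing the first factor, the quotient of that factor by the
fiber congruence is an abelian group. -/
theorem exists_commGroup_quotient {A : Type u} {B D : Type*} [Loop A] [Loop B] [Loop D]
    (C : Subloop (A × B × D)) (h₁ : ∀ a b, ∃ d, (a, b, d) ∈ C) (h₂ : ∀ a d, ∃ b, (a, b, d) ∈ C) :
    ∃ (G : Type u) (_ : CommGroup G) (q : A →* G), Function.Surjective q ∧
      ∀ a a', q a = q a' ↔ ∃ p, (a, p) ∈ C ∧ (a', p) ∈ C := by
  let c : Con A := fiberCon C fun a => (h₁ a 1).elim fun d h => ⟨(1, d), h⟩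
  let G : CommGroup c.Quotient :=
    { (inferInstance : MulOneClass c.Quotient) with
      mul_assoc := by
        rintro ⟨x⟩ ⟨y⟩ ⟨z⟩
        obtain ⟨d, hx⟩ := h₁ x 1
        obtain ⟨b, hy⟩ := h₂ y 1
        obtain ⟨e, hz⟩ := h₁ z 1
        have l : (x * y * z, 1 * b * 1, d * 1 * e) ∈ C := C.mul_mem (C.mul_mem hx hy) hz
        have r : (x * (y * z), 1 * (b * 1), d * (1 * e)) ∈ C := C.mul_mem hx (C.mul_mem hy hz)
        simp only [mul_one, one_mul] at l r
        exact c.eq.2 ⟨(b, d * e), l, r⟩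
      mul_comm := by
        rintro ⟨x⟩ ⟨y⟩
        obtain ⟨d, hx⟩ := h₁ x 1
        obtain ⟨b, hy⟩ := h₂ y 1
        have l : (x * y, 1 * b, d * 1) ∈ C := C.mul_mem hx hy
        have r : (y * x, b * 1, 1 * d) ∈ C := C.mul_mem hy hx
        simp only [mul_one, one_mul] at l r
        exact c.eq.2 ⟨(b, d), l, r⟩
      inv := Quotient.map' (s₁ := c.toSetoid) (s₂ := c.toSetoid) (fun a => Loop.ldiv a 1)
        fun _ _ ⟨b, h, h'⟩ => ⟨Loop.ldiv b 1, C.ldiv_mem h C.one_mem, C.ldiv_mem h' C.one_mem⟩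
      inv_mul_cancel := by
        rintro ⟨x⟩
        obtain ⟨d, hx⟩ := h₁ x 1
        obtain ⟨b, hy⟩ := h₂ (Loop.ldiv x 1) 1
        have l : (Loop.ldiv x 1 * x, b * 1, 1 * d) ∈ C := C.mul_mem hy hx
        have r : (x * Loop.ldiv x 1, 1 * b, d * 1) ∈ C := C.mul_mem hx hy
        simp only [mul_one, one_mul, Loop.mul_ldiv] at l r
        exact c.eq.2 ⟨(b, d), l, r⟩ }
  exact ⟨c.Quotient, G, ⟨⟨fun a => (a : c.Quotient), rfl⟩, fun _ _ => rfl⟩, Quotient.mk''_surjective,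
    fun _ _ => c.eq⟩

theorem _root_.Subgroup.exists_finite_closure_eq_of_fg {G : Type*} [CommGroup G] [Group.FG G]
    (H : Subgroup G) : ∃ S : Set G, S.Finite ∧ Subgroup.closure S = H := by
  have : Module.Finite ℤ (Additive G) := Module.Finite.iff_addGroup_fg.2 inferInstance
  have hfg := (Submodule.fg_iff_addSubgroup_fg (AddSubgroup.toIntSubmodule H.toAddSubgroup)).1
    (IsNoetherian.noetherian _)
  obtain ⟨S, hS, hfin⟩ := (Subgroup.fg_iff H).1 ((Subgroup.fg_iff_add_fg H).2 (by simpa using hfg))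
  exact ⟨S, hfin, hS⟩

theorem _root_.Loop.FG.group_fg {G : Type*} [Group G] (hA : Loop.FG A) (q : A →* G)
    (hq : Function.Surjective q) : Group.FG G := by
  obtain ⟨X, hXf, hX⟩ := hA
  refine Group.fg_iff.2 ⟨q '' X, ?_, hXf.image q⟩
  refine (Subgroup.eq_top_iff' _).2 fun g => ?_
  obtain ⟨a, rfl⟩ := hq g
  exact mem_of_closure_eq_top (S := comapSubgroup q (Subgroup.closure (q '' X))) hX
    (fun x hx => Subgroup.subset_closure ⟨x, hx, rfl⟩) a

/-! ### Generating a subloop that is surjective on pairs -/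

/-- If `C₀ ≤ D` projects onto `B` and the elements `(n, 1)` of `C` are, up to the fiber congruence
of `C₀`, elements of `D`, then `C ≤ D`. -/
theorem le_of_fiber_image_le {C C₀ D : Subloop (A × B)} (hC₀ : C₀ ≤ C) (hD : C₀ ≤ D)
    (hB : ∀ b, ∃ a, (a, b) ∈ C₀)
    (h : ∀ n, (n, 1) ∈ C → ∃ k, (k, 1) ∈ D ∧ ∃ b, (n, b) ∈ C₀ ∧ (k, b) ∈ C₀) : C ≤ D := by
  rintro ⟨a, b⟩ hab
  obtain ⟨a₀, ha₀⟩ := hB b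
  have hn : (Loop.rdiv a a₀, Loop.rdiv b b) ∈ C := C.rdiv_mem hab (hC₀ ha₀)
  have hb : Loop.rdiv b b = 1 := by simpa using Loop.mul_rdiv (1 : B) b
  rw [hb] at hn
  obtain ⟨k, hk, b', h₁, h₂⟩ := h _ hn
  have hmul : (Loop.rdiv a a₀ * a₀, 1 * b) ∈ D :=
    D.mul_mem (D.rectangular (hD h₂) (hD h₁) hk) (hD ha₀)
  rwa [Loop.rdiv_mul, one_mul] at hmul

theorem exists_fg_surjectiveOnPairs {A₁ A₂ A₃ : Type*} [Loop A₁] [Loop A₂] [Loop A₃]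
    (h₁ : Loop.FG A₁) (h₂ : Loop.FG A₂) (h₃ : Loop.FG A₃) {C : Subloop (A₁ × A₂ × A₃)}
    (hC : C.SurjectiveOnPairs) :
    ∃ X : Set (A₁ × A₂ × A₃), X.Finite ∧ X ⊆ C ∧ (closure X).SurjectiveOnPairs := by
  simp only [SurjectiveOnPairs, Set.eq_univ_iff_forall] at hC ⊢
  let p₁ := MonoidHom.fst A₁ (A₂ × A₃)
  let p₂ := (MonoidHom.fst A₂ A₃).comp (MonoidHom.snd A₁ (A₂ × A₃))
  let p₃ := (MonoidHom.snd A₂ A₃).comp (MonoidHom.snd A₁ (A₂ × A₃))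
  obtain ⟨X, hXf, hXC, hX⟩ := exists_finite_lift h₁ h₂ (p₁.prod p₂) C hC.1
  obtain ⟨Y, hYf, hYC, hY⟩ := exists_finite_lift h₁ h₃ (p₁.prod p₃) C hC.2.1
  obtain ⟨Z, hZf, hZC, hZ⟩ := exists_finite_lift h₂ h₃ (p₂.prod p₃) C hC.2.2
  have hsub := subset_closure (X ∪ Y ∪ Z)
  refine ⟨X ∪ Y ∪ Z, (hXf.union hYf).union hZf,
    Set.union_subset (Set.union_subset hXC hYC) hZC, hX _ ?_, hY _ ?_, hZ _ ?_⟩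
  · exact fun x hx => hsub (Or.inl (Or.inl hx))
  · exact fun x hx => hsub (Or.inl (Or.inr hx))
  · exact fun x hx => hsub (Or.inr hx)

end Subloop

open Subloop in
theorem corollary5p7 {A₁ A₂ A₃ : Type*} [Loop A₁] [Loop A₂] [Loop A₃]
    (h₁ : Loop.FG A₁) (h₂ : Loop.FG A₂) (h₃ : Loop.FG A₃)
    (C : Subloop (A₁ × A₂ × A₃)) (hsd : C.IsSubdirect) (hpairs : C.SurjectiveOnPairs) :
    C.FG := by
  obtain ⟨X, hXf, hXC, hX⟩ := exists_fg_surjectiveOnPairs h₁ h₂ h₃ hpairs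
  simp only [SurjectiveOnPairs, Set.eq_univ_iff_forall] at hX
  obtain ⟨h12, h13, h23⟩ := hX
  obtain ⟨G, _, q, hq, hqC⟩ := exists_commGroup_quotient (closure X)
    (fun a b => by obtain ⟨⟨_, _, d⟩, h, ⟨⟩⟩ := h12 (a, b); exact ⟨d, h⟩)
    (fun a d => by obtain ⟨⟨_, b, _⟩, h, ⟨⟩⟩ := h13 (a, d); exact ⟨b, h⟩)
  have : Group.FG G := h₁.group_fg q hq
  let i := MonoidHom.inl A₁ (A₂ × A₃)
  obtain ⟨S, hSf, hS⟩ := (mapSubgroup q (comap i C)).exists_finite_closure_eq_of_fg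
  have hSsub : S ⊆ q '' (comap i C : Set A₁) := fun s hs => by
    have : s ∈ mapSubgroup q (comap i C) := hS ▸ Subgroup.subset_closure hs
    exact this
  obtain ⟨Y, hYC, hYf, hS⟩ := Set.exists_subset_image_finite_and
    (p := fun T => Subgroup.closure T = mapSubgroup q (comap i C)) |>.1 ⟨S, hSsub, hSf, hS⟩
  refine ⟨X ∪ i '' Y, hXf.union (hYf.image i), le_antisymm ?_ ?_⟩
  · refine closure_le (Set.union_subset hXC ?_)
    rintro _ ⟨y, hy, rfl⟩
    exact hYC hy
  · refine le_of_fiber_image_le (C₀ := closure X) (closure_le hXC)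
      (closure_le (Set.subset_union_left.trans (subset_closure _))) (fun p => ?_) fun n hn => ?_
    · obtain ⟨⟨a, _, _⟩, h, ⟨⟩⟩ := h23 p
      exact ⟨a, h⟩
    · have hle : Subgroup.closure (q '' Y) ≤
          mapSubgroup q (comap i (closure (X ∪ i '' Y))) := by
        rw [Subgroup.closure_le]
        rintro _ ⟨y, hy, rfl⟩
        exact ⟨y, subset_closure _ (Or.inr ⟨y, hy, rfl⟩), rfl⟩
      have hqn : q n ∈ Subgroup.closure (q '' Y) := by
        rw [hS]
        exact ⟨n, hn, rfl⟩
      obtain ⟨k, hk, hkn⟩ := hle hqn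
      exact ⟨k, hk, (hqC n k).1 hkn.symm⟩
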